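/- Let $d\ge 1$, $p=\frac{2d+1}{4d}$ and $\alpha>\frac12$. Let $e_1,\dots,e_d$ be the standard basis of $\mathbb R^d$, and let $J_d$ be the cyclic permutation matrix of order $d$ with $(J_d)_{i,i+1}=1$ for $1\le i<d$, $(J_d)_{d,1}=1$, and all other entries $0$. The multidimensional elephant random walk with random step sizes is given, on a probability space, by directions $(X_n)_{n\ge1}$, random matrices $(A_n)_{n\ge2}$, random times $(\beta(n))_{n\ge1}$ and step sizes $(Y_n)_{n\ge1}$ such that: - $X_1$ is uniformly distributed on $\{\pm e_1,\dots,\pm e_d\}$, and $X_{n+1}=A_{n+1}X_{\beta(n)}$ almost surely for $n\ge1$; - for $n\ge 1$, $\beta(n)$ is uniformly distributed on $\{1,\dots,n\}$, and $A_{n+1}$ equals $I_d$ with probability $p$ and each of the $2d-1$ matrices $-I_d,\pm J_d,\dots,\pm J_d^{d-1}$ with probability $\frac{1-p}{2d-1}$; - $Y_1>0$ almost surely, with finite mean and variance; $Y_2,Y_3,\dots$ are non-negative, independent and identically distributed with finite mean and variance; - for every $n\ge1$, the random variables $A_{n+1}$, $\beta(n)$, $Y_{n+1}$ are mutually independent,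 and the triple $(A_{n+1},\beta(n),Y_{n+1})$ is independent of $(X_1,\dots,X_n,Y_1,\dots,Y_n)$. Let $T_1=X_1Y_1$, $T_{n+1}=A_{n+1}X_{\beta(n)}Y_{n+1}$ for $n\ge1$, and $S_n=\sum_{k=1}^nT_k$. Then $$\lim_{n\to\infty}\frac{S_n}{\sqrt n\,(\log n)^{\alpha}}=0\quad\text{almost surely.}$$ -/

import Mathlib

open MeasureTheory ProbabilityTheory Filter Topology
open scoped Matrix

namespace MERW

/-- The cyclic permutation matrix `J_d`, with ones at the positions `(i, i + 1)` (cyclically). -/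
def shiftMatrix (d : ℕ) : Matrix (Fin d) (Fin d) ℝ :=
  Matrix.of fun i j => if (j : ℕ) = ((i : ℕ) + 1) % d then 1 else 0

/-- The data driving a `d`-dimensional elephant random walk with memory parameter `p` and random
step sizes: directions `X n` (`n ≥ 1`), random matrices `A n` (`n ≥ 2`), recalled times `β n`
(`n ≥ 1`) and step sizes `Y n` (`n ≥ 1`). All other indices are irrelevant. -/
structure IsModel {Ω : Type*} [MeasurableSpace Ω] (P : Measure Ω) (d : ℕ) (p : ℝ)
    (X : ℕ → Ω → (Fin d → ℝ)) (A : ℕ → Ω → Matrix (Fin d) (Fin d) ℝ)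
    (β : ℕ → Ω → ℕ) (Y : ℕ → Ω → ℝ) : Prop where
  measurable_X : ∀ n, 1 ≤ n → Measurable (X n)
  measurable_A : ∀ n, 1 ≤ n → ∀ i j, Measurable fun ω => A (n + 1) ω i j
  measurable_β : ∀ n, 1 ≤ n → Measurable (β n)
  measurable_Y : ∀ n, 1 ≤ n → Measurable (Y n)
  /-- `X 1` is uniform on the `2d` vectors `±e_i`. -/
  law_X_one : ∀ i : Fin d,
    P.real {ω | X 1 ω = Pi.single i 1} = 1 / (2 * (d : ℝ)) ∧
    P.real {ω | X 1 ω = -Pi.single i 1} = 1 / (2 * (d : ℝ))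
  /-- `A (n + 1)` is `I` with probability `p` and each of the other `2d - 1` signed powers of `J`
  with probability `(1 - p) / (2d - 1)`. -/
  law_A_one : ∀ n, 1 ≤ n → P.real {ω | A (n + 1) ω = 1} = p
  law_A_neg_one : ∀ n, 1 ≤ n →
    P.real {ω | A (n + 1) ω = -1} = (1 - p) / (2 * (d : ℝ) - 1)
  law_A_pow : ∀ n, 1 ≤ n → ∀ i, 1 ≤ i → i < d →
    P.real {ω | A (n + 1) ω = shiftMatrix d ^ i} = (1 - p) / (2 * (d : ℝ) - 1) ∧
    P.real {ω | A (n + 1) ω = -shiftMatrix d ^ i} = (1 - p) / (2 * (d : ℝ) - 1)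
  /-- `β n` is uniform on `{1, …, n}`. -/
  law_β : ∀ n, 1 ≤ n → ∀ k ∈ Finset.Icc 1 n, P.real {ω | β n ω = k} = 1 / (n : ℝ)
  /-- Each new direction is obtained from a recalled one. -/
  X_succ : ∀ n, 1 ≤ n → ∀ᵐ ω ∂P, X (n + 1) ω = A (n + 1) ω *ᵥ X (β n ω) ω
  Y_one_pos : ∀ᵐ ω ∂P, 0 < Y 1 ω
  Y_nonneg : ∀ n, 2 ≤ n → ∀ᵐ ω ∂P, 0 ≤ Y n ω
  /-- Finite mean and variance. -/
  memLp_Y : ∀ n, 1 ≤ n → MemLp (Y n) 2 P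
  identDistrib_Y : ∀ n, 2 ≤ n → IdentDistrib (Y n) (Y 2) P P
  /-- The next two fields: `A (n + 1)`, `β n`, `Y (n + 1)` are mutually independent. -/
  indep_A_β : ∀ n, 1 ≤ n →
    IndepFun (fun ω (i j : Fin d) => A (n + 1) ω i j) (β n) P
  indep_Aβ_Y : ∀ n, 1 ≤ n →
    IndepFun (fun ω => ((fun i j : Fin d => A (n + 1) ω i j), β n ω)) (Y (n + 1)) P
  /-- The triple is independent of the past `X 1, …, X n, Y 1, …, Y n`. Together with
  `identDistrib_Y` this makes `Y 2, Y 3, …` independent and identically distributed. -/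
  indep_past : ∀ n, 1 ≤ n →
    IndepFun (fun ω => ((fun i j : Fin d => A (n + 1) ω i j), β n ω, Y (n + 1) ω))
      (fun ω (k : Finset.Icc 1 n) => (X k ω, Y k ω)) P

/-- The steps: `T 1 = X 1 Y 1` and `T (n + 1) = A (n + 1) X (β n) Y (n + 1)` for `n ≥ 1`. -/
def step {Ω : Type*} {d : ℕ} (X : ℕ → Ω → (Fin d → ℝ)) (A : ℕ → Ω → Matrix (Fin d) (Fin d) ℝ)
    (β : ℕ → Ω → ℕ) (Y : ℕ → Ω → ℝ) : ℕ → Ω → (Fin d → ℝ)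
  | 0 => fun _ => 0
  | 1 => fun ω => Y 1 ω • X 1 ω
  | n + 2 => fun ω => Y (n + 2) ω • (A (n + 2) ω *ᵥ X (β (n + 1) ω) ω)

/-- The position `S n = T 1 + ⋯ + T n`. -/
def position {Ω : Type*} {d : ℕ} (X : ℕ → Ω → (Fin d → ℝ))
    (A : ℕ → Ω → Matrix (Fin d) (Fin d) ℝ)
    (β : ℕ → Ω → ℕ) (Y : ℕ → Ω → ℝ) (n : ℕ) (ω : Ω) : Fin d → ℝ :=
  ∑ k ∈ Finset.Icc 1 n, step X A β Y k ω

end MERW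

/-! The signed powers `J^k` and `-J^k` cancel in the mean except for the excess mass at the
identity, and at this critical `p` that excess is exactly `1/2`. Hence `E[X (n+1) | past] = (1/(2n))
∑_{k ≤ n} X k` (`condExp_weighted_X`). Multiplying `∑_{k ≤ n} X k` by `damping n`, of order
`n^(-1/2)`, turns each coordinate into a martingale whose increments have second moment `O(1/n)`.

Almost surely `T k = (Y k - μ) X k + μ X k` with `μ = E[Y 2]`. For `k ≥ 2` the first terms are
martingale differences with bounded second moments. Both sums are then controlled by one strong law,
`ae_tendsto_sum_div_of_condExp_eq_zero`: L² orthogonality, martingale convergence, Kronecker's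
lemma. The norming costs `(log n)^α` because `∑ 1/(n (log n)^(2α))` converges precisely for `α >
1/2`. -/

namespace MERW

/-! ### A strong law for martingale differences -/

/-- **Kronecker's lemma**. -/
theorem tendsto_sum_div_of_tendsto_sum {b x : ℕ → ℝ} {u : ℝ} (hb : ∀ n, 0 < b n)
    (hmono : Monotone b) (htop : Tendsto b atTop atTop)
    (hx : Tendsto (fun n => ∑ k ∈ Finset.range n, x k / b k) atTop (𝓝 u)) :
    Tendsto (fun n => (∑ k ∈ Finset.range n, x k) / b n) atTop (𝓝 0) := by
  set v : ℕ → ℝ := fun n => (∑ k ∈ Finset.range n, x k / b k) - u with hv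
  have hv0 : Tendsto v atTop (𝓝 0) := by simpa [hv] using hx.sub_const u
  -- Summation by parts: `x n = b n (v (n+1) - v n)`, where `v` is the partial sum recentred to tend
  -- to `0`.
  have habel : ∀ n, ∑ k ∈ Finset.range n, x k =
      b n * v n - b 0 * v 0 - ∑ k ∈ Finset.range n, v (k + 1) * (b (k + 1) - b k) := by
    intro n
    induction n with
    | zero => simp
    | succ n ih =>
      have h1 : v (n + 1) = v n + x n / b n := by
        simp only [hv, Finset.sum_range_succ]; ring
      have h2 : b n * (x n / b n) = x n := by field_simp [(hb n).ne']
      rw [Finset.sum_range_succ, ih, Finset.sum_range_succ, h1]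
      linear_combination -h2
  have htel : ∀ n, ∑ k ∈ Finset.range n, (b (k + 1) - b k) = b n - b 0 := fun n =>
    Finset.sum_range_sub b n
  -- A weighted Cesàro mean of a null sequence, with nonnegative weights of divergent sum.
  have hlit : (fun n => ∑ k ∈ Finset.range n, v (k + 1) * (b (k + 1) - b k)) =o[atTop]
      fun n => ∑ k ∈ Finset.range n, (b (k + 1) - b k) := by
    refine Asymptotics.IsLittleO.sum_range ?_ (fun k => sub_nonneg.2 (hmono k.le_succ)) ?_
    · have h1 : (fun k => v (k + 1)) =o[atTop] fun _ : ℕ => (1 : ℝ) :=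
        (Asymptotics.isLittleO_one_iff ℝ).2 (hv0.comp (tendsto_add_atTop_nat 1))
      simpa using h1.mul_isBigO (Asymptotics.isBigO_refl (fun k => b (k + 1) - b k) atTop)
    · simp only [htel]
      exact tendsto_atTop_add_const_right _ _ htop
  have hbig : (fun n => ∑ k ∈ Finset.range n, (b (k + 1) - b k)) =O[atTop] b := by
    simp only [htel]
    refine Asymptotics.IsBigO.of_bound 1 (Eventually.of_forall fun n => ?_)
    rw [Real.norm_of_nonneg (sub_nonneg.2 (hmono (Nat.zero_le n))),
      Real.norm_of_nonneg (hb n).le]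
    linarith [hb 0]
  have h3 := (hlit.trans_isBigO hbig).tendsto_div_nhds_zero
  have h4 : Tendsto (fun n => b 0 * v 0 / b n) atTop (𝓝 0) := htop.const_div_atTop _
  have h5 := (hv0.sub h4).sub h3
  simp only [sub_zero] at h5
  refine h5.congr fun n => ?_
  rw [habel n]
  field_simp [(hb n).ne']

/-- A strong law for square-integrable martingale differences: if `∑ E[D k ^ 2] / b k ^ 2 < ∞`
then `∑ k < n, D k = o(b n)` almost surely. -/
theorem ae_tendsto_sum_div_of_condExp_eq_zero {Ω : Type*} {m : MeasurableSpace Ω} {P : Measure Ω}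
    [IsProbabilityMeasure P] (ℱ : Filtration ℕ m) {D : ℕ → Ω → ℝ} {b c : ℕ → ℝ}
    (hb : ∀ n, 0 < b n) (hmono : Monotone b) (htop : Tendsto b atTop atTop)
    (hmeas : ∀ k, 1 ≤ k → StronglyMeasurable[ℱ (k + 1)] (D k))
    (hL2 : ∀ k, 1 ≤ k → MemLp (D k) 2 P)
    (hzero : ∀ k, 1 ≤ k → P[D k | ℱ k] =ᵐ[P] 0)
    (hc : ∀ k, 1 ≤ k → ∫ ω, D k ω ^ 2 ∂P ≤ c k)
    (hsum : Summable fun k => c k / b k ^ 2) :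
    ∀ᵐ ω ∂P, Tendsto (fun n => (∑ k ∈ Finset.range n, D k ω) / b n) atTop (𝓝 0) := by
  -- The hypotheses on `D` start at `k = 1`, so `D 0` is removed from the martingale. It only shifts
  -- the limit, and is put back when Kronecker's lemma is applied.
  set G : ℕ → Ω → ℝ := fun k => if k = 0 then 0 else (b k)⁻¹ • D k with hG
  set M : ℕ → Ω → ℝ := fun n => ∑ k ∈ Finset.range n, G k with hM
  have hGL2 : ∀ k, MemLp (G k) 2 P := by
    intro k
    by_cases hk : k = 0
    · simp [hG, hk]
    · simp only [hG, hk, if_false]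
      exact (hL2 k (by omega)).const_smul _
  have hGmeas : ∀ k, StronglyMeasurable[ℱ (k + 1)] (G k) := by
    intro k
    by_cases hk : k = 0
    · simp only [hG, hk, if_true]
      exact stronglyMeasurable_zero
    · simp only [hG, hk, if_false]
      exact (hmeas k (by omega)).const_smul _
  have hGzero : ∀ k, P[G k | ℱ k] =ᵐ[P] 0 := by
    intro k
    by_cases hk : k = 0
    · simp [hG, hk]
    · simp only [hG, hk, if_false]
      refine (condExp_smul _ _ _).trans ?_
      filter_upwards [hzero k (by omega)] with ω hω
      simp [hω]
  have hML2 : ∀ n, MemLp (M n) 2 P := fun n => memLp_finsetSum' _ fun k _ => hGL2 k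
  have hMmeas : StronglyAdapted ℱ M := fun n =>
    Finset.stronglyMeasurable_sum _ fun k hk =>
      (hGmeas k).mono (ℱ.mono (by have := Finset.mem_range.1 hk; omega))
  have hMsucc : ∀ n, M (n + 1) = M n + G n := fun n => Finset.sum_range_succ _ _
  have hmart : Martingale M ℱ P := by
    refine martingale_of_condExp_sub_eq_zero_nat hMmeas
      (fun n => (hML2 n).integrable (by norm_num)) fun n => ?_
    rw [hMsucc, add_sub_cancel_left]
    exact hGzero n
  -- Orthogonality of increments: conditioning on `ℱ n` pulls out `M n` and kills `G n`.
  have horth : ∀ n, ∫ ω, M n ω * G n ω ∂P = 0 := by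
    intro n
    have hint : Integrable (M n * G n) P := (hML2 n).integrable_mul (hGL2 n)
    have h1 := condExp_mul_of_aestronglyMeasurable_left (hMmeas n).aestronglyMeasurable hint
      ((hGL2 n).integrable (by norm_num))
    calc ∫ ω, M n ω * G n ω ∂P = ∫ ω, (P[M n * G n | ℱ n]) ω ∂P :=
          (integral_condExp (ℱ.le n)).symm
      _ = ∫ _, 0 ∂P := by
          refine integral_congr_ae ?_
          filter_upwards [h1, hGzero n] with ω h2 h3
          simp [h2, h3]
      _ = 0 := by simp
  have hGsq : ∀ k, 1 ≤ k → ∫ ω, G k ω ^ 2 ∂P ≤ c k / b k ^ 2 := by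
    intro k hk
    have h1 : ∀ ω, G k ω ^ 2 = (b k ^ 2)⁻¹ * D k ω ^ 2 := by
      intro ω
      simp only [hG, show k ≠ 0 by omega, if_false, Pi.smul_apply, smul_eq_mul]
      rw [mul_pow, inv_pow]
    simp only [h1]
    rw [integral_const_mul, div_eq_inv_mul]
    exact mul_le_mul_of_nonneg_left (hc k hk) (inv_nonneg.2 (sq_nonneg _))
  have hMsq : ∀ n, ∫ ω, M (n + 1) ω ^ 2 ∂P ≤ ∑ k ∈ Finset.Ico 1 (n + 1), c k / b k ^ 2 := by
    intro n
    induction n with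
    | zero => simp [hM, hG]
    | succ n ih =>
      have h1 : ∀ ω, M (n + 1 + 1) ω ^ 2 =
          M (n + 1) ω ^ 2 + 2 * (M (n + 1) ω * G (n + 1) ω) + G (n + 1) ω ^ 2 := by
        intro ω
        rw [hMsucc (n + 1), Pi.add_apply]; ring
      have hint : Integrable (fun ω => M (n + 1) ω * G (n + 1) ω) P :=
        (hML2 (n + 1)).integrable_mul (hGL2 (n + 1))
      have hint' : Integrable
          (fun ω => M (n + 1) ω ^ 2 + 2 * (M (n + 1) ω * G (n + 1) ω)) P :=
        ((hML2 (n + 1)).integrable_sq).add (hint.const_mul 2)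
      simp only [h1]
      rw [integral_add hint' ((hGL2 (n + 1)).integrable_sq),
        integral_add ((hML2 (n + 1)).integrable_sq) (hint.const_mul 2), integral_const_mul,
        horth (n + 1), Finset.sum_Ico_succ_top (by omega)]
      have := hGsq (n + 1) (by omega)
      linarith
  have hcnn : ∀ k, 1 ≤ k → 0 ≤ c k / b k ^ 2 := fun k hk =>
    (integral_nonneg fun ω => sq_nonneg _).trans (hGsq k hk)
  obtain ⟨R, hR⟩ : ∃ R : ℝ, ∀ n, ∑ k ∈ Finset.Ico 1 (n + 1), c k / b k ^ 2 ≤ R := by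
    refine ⟨∑' k, c (k + 1) / b (k + 1) ^ 2, fun n => ?_⟩
    rw [Finset.sum_Ico_eq_sum_range]
    simp only [add_comm 1]
    exact Summable.sum_le_tsum _ (fun k _ => hcnn _ (by omega))
      ((summable_nat_add_iff 1).2 hsum)
  have hR0 : 0 ≤ R := by simpa using hR 0
  have hMsq' : ∀ n, ∫ ω, M n ω ^ 2 ∂P ≤ R := by
    intro n
    cases n with
    | zero => simpa [hM] using hR0
    | succ n => exact (hMsq n).trans (hR n)
  -- The convergence theorem asks for an L¹ bound; `|x| ≤ x² + 1` derives it from the L² bound.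
  have hbdd : ∀ n, eLpNorm (M n) 1 P ≤ ((R + 1).toNNReal : ENNReal) := by
    intro n
    have hi : Integrable (M n) P := (hML2 n).integrable (by norm_num)
    rw [eLpNorm_one_eq_lintegral_enorm, ← ofReal_integral_norm_eq_lintegral_enorm hi]
    refine ENNReal.ofReal_le_ofReal ?_
    calc ∫ ω, ‖M n ω‖ ∂P ≤ ∫ ω, (M n ω ^ 2 + 1) ∂P := by
          refine integral_mono hi.norm (((hML2 n).integrable_sq).add (integrable_const 1)) ?_
          intro ω
          simp only [Real.norm_eq_abs]
          nlinarith [sq_nonneg (|M n ω| - 1), sq_abs (M n ω), sq_nonneg (M n ω)]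
      _ = ∫ ω, M n ω ^ 2 ∂P + 1 := by
          rw [integral_add ((hML2 n).integrable_sq) (integrable_const 1)]; simp
      _ ≤ R + 1 := by linarith [hMsq' n]
  filter_upwards [hmart.submartingale.exists_ae_tendsto_of_bdd hbdd] with ω hω
  obtain ⟨l, hl⟩ := hω
  refine tendsto_sum_div_of_tendsto_sum (u := l + D 0 ω / b 0) hb hmono htop ?_
  refine (tendsto_add_atTop_iff_nat 1).1
    (((hl.add_const (D 0 ω / b 0)).comp (tendsto_add_atTop_nat 1)).congr fun n => ?_)
  simp only [Function.comp, hM, Finset.sum_apply]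
  rw [Finset.sum_range_succ', Finset.sum_range_succ']
  simp [hG, div_eq_inv_mul]

/-! ### The logarithmic series and the damping sequence -/

/-- Cauchy condensation reduces this to `∑ (k log 2)^(-s)`. -/
theorem summable_inv_mul_one_add_log_rpow {s : ℝ} (hs : 1 < s) :
    Summable fun n : ℕ => 1 / (((n : ℝ) + 1) * (1 + Real.log ((n : ℝ) + 1)) ^ s) := by
  have hs0 : 0 ≤ s := by linarith
  suffices h : Summable fun n : ℕ => 1 / ((n : ℝ) * (1 + Real.log n) ^ s) by
    simpa using (summable_nat_add_iff 1).2 h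
  have hlog : ∀ n : ℕ, 0 ≤ Real.log n := fun n => Real.log_natCast_nonneg n
  rw [← summable_condensed_iff_of_nonneg]
  · have h2 : Summable fun k : ℕ => (Real.log 2 ^ s)⁻¹ * (1 / (k : ℝ) ^ s) :=
      (Real.summable_one_div_nat_rpow.2 hs).mul_left _
    have hl2 : 0 < Real.log 2 := Real.log_pos (by norm_num)
    -- The comparison fails at `k = 0`, where `1 / 0 ^ s` is `0` by convention.
    rw [← summable_nat_add_iff 1] at h2 ⊢
    refine Summable.of_nonneg_of_le (fun k => ?_) (fun k => ?_) h2
    · have := hlog (2 ^ (k + 1))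
      positivity
    · push_cast
      rw [Real.log_pow]
      push_cast
      have h3 : (0 : ℝ) < ((k : ℝ) + 1) * Real.log 2 := by positivity
      have h4 : (((k : ℝ) + 1) * Real.log 2) ^ s ≤ (1 + ((k : ℝ) + 1) * Real.log 2) ^ s :=
        Real.rpow_le_rpow h3.le (by linarith) hs0
      have h5 : 0 < (((k : ℝ) + 1) * Real.log 2) ^ s := Real.rpow_pos_of_pos h3 s
      calc (2 : ℝ) ^ (k + 1) * (1 / (2 ^ (k + 1) * (1 + ((k : ℝ) + 1) * Real.log 2) ^ s))
          = 1 / (1 + ((k : ℝ) + 1) * Real.log 2) ^ s := by field_simp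
        _ ≤ 1 / (((k : ℝ) + 1) * Real.log 2) ^ s := one_div_le_one_div_of_le h5 h4
        _ = _ := by
          rw [Real.mul_rpow (by positivity) hl2.le]
          field_simp
  · intro n
    have := hlog n
    positivity
  · intro m n hm hmn
    have hm' : (0 : ℝ) < m := by exact_mod_cast hm
    have hmn' : (m : ℝ) ≤ n := by exact_mod_cast hmn
    have h1 := hlog m
    have h2 : Real.log m ≤ Real.log n := Real.log_le_log hm' hmn'
    have h3 : (1 + Real.log m) ^ s ≤ (1 + Real.log n) ^ s :=
      Real.rpow_le_rpow (by linarith) (by linarith) hs0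
    have h4 : 0 < (1 + Real.log m) ^ s := Real.rpow_pos_of_pos (by linarith) s
    exact one_div_le_one_div_of_le (by positivity)
      (mul_le_mul hmn' h3 h4.le (hm'.le.trans hmn'))

/-- The norming sequence `∏ (1 + 1 / (2 k))⁻¹` of the critical walk. -/
noncomputable def damping : ℕ → ℝ
  | 0 => 1
  -- Division by zero gives `damping 1 = 1`, so the product for `damping n` runs over `1 ≤ k < n`.
  | n + 1 => damping n / (1 + 1 / (2 * (n : ℝ)))

theorem damping_pos (n : ℕ) : 0 < damping n := by
  induction n with
  | zero => simp [damping]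
  | succ n ih => rw [damping]; positivity

theorem damping_sq_le (n : ℕ) : damping (n + 1) ^ 2 ≤ 1 / ((n : ℝ) + 1) := by
  induction n with
  | zero => simp [damping]
  | succ n ih =>
    rw [damping, div_pow]
    push_cast
    refine (div_le_div_of_nonneg_right ih (by positivity)).trans ?_
    rw [div_div]
    refine one_div_le_one_div_of_le (by positivity) ?_
    have : ((n : ℝ) + 1) * (1 + 1 / (2 * ((n : ℝ) + 1))) ^ 2 =
        (n : ℝ) + 1 + 1 + 1 / (4 * ((n : ℝ) + 1)) := by field_simp; ring
    rw [this]
    have : 0 ≤ 1 / (4 * ((n : ℝ) + 1)) := by positivity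
    linarith

/-- The right side decreases with `n`, so a constant lower bound is not inductive. The factor `1 +
1/(n+1)` decreases fast enough to close the induction, with equality at `n = 0`. -/
theorem le_damping_sq (n : ℕ) :
    1 / 2 * (1 + 1 / ((n : ℝ) + 1)) ≤ ((n : ℝ) + 1) * damping (n + 1) ^ 2 := by
  induction n with
  | zero => norm_num [damping]
  | succ n ih =>
    rw [damping, div_pow]
    push_cast
    set x : ℝ := (n : ℝ) + 1 with hx
    have hx0 : 1 ≤ x := by simp [hx]
    have hx1 : 0 < x := by linarith
    have h1 : 1 / 2 * (1 + 1 / x) / x ≤ damping (n + 1) ^ 2 := by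
      rw [div_le_iff₀ hx1]; linarith
    have h2 : 1 / 2 * (1 + 1 / (x + 1)) ≤
        (x + 1) * (1 / 2 * (1 + 1 / x) / x / (1 + 1 / (2 * x)) ^ 2) := by
      have e1 : (x + 1) * (1 / 2 * (1 + 1 / x) / x / (1 + 1 / (2 * x)) ^ 2) =
        (2 * (x + 1) ^ 2) / (2 * x + 1) ^ 2 := by field_simp
      have e2 : 1 / 2 * (1 + 1 / (x + 1)) = (x + 2) / (2 * (x + 1)) := by field_simp; ring
      rw [e1, e2, div_le_div_iff₀ (by positivity) (by positivity)]
      nlinarith [mul_pos hx1 hx1, mul_pos hx1 (mul_pos hx1 hx1)]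
    refine h2.trans ?_
    gcongr

/-! ### Signed powers of the cyclic permutation matrix -/

theorem shiftMatrix_pow_apply (d k : ℕ) (i j : Fin d) :
    (shiftMatrix d ^ k) i j = if (j : ℕ) = ((i : ℕ) + k) % d then 1 else 0 := by
  induction k generalizing j with
  | zero => simp [Matrix.one_apply, Nat.mod_eq_of_lt i.2, Fin.ext_iff, eq_comm]
  | succ k ih =>
    have hd : 0 < d := i.pos
    rw [pow_succ, Matrix.mul_apply,
      Finset.sum_eq_single ⟨((i : ℕ) + k) % d, Nat.mod_lt _ hd⟩]
    · rw [ih]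
      simp [shiftMatrix, add_assoc]
    · intro l _ hl
      rw [ih, if_neg fun h => hl (Fin.ext h), zero_mul]
    · simp

/-- The `2 d` signed powers of the shift matrix. -/
def signedPower (d : ℕ) : Fin d ⊕ Fin d → Fin d → Fin d → ℝ :=
  Sum.elim (fun i => shiftMatrix d ^ (i : ℕ)) fun i => -(shiftMatrix d ^ (i : ℕ))

theorem signedPower_inl (d : ℕ) (k i j : Fin d) :
    signedPower d (Sum.inl k) i j = if (j : ℕ) = ((i : ℕ) + k) % d then 1 else 0 :=
  shiftMatrix_pow_apply d k i j

theorem signedPower_inr (d : ℕ) (k i j : Fin d) :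
    signedPower d (Sum.inr k) i j = -if (j : ℕ) = ((i : ℕ) + k) % d then 1 else 0 :=
  congrArg Neg.neg (shiftMatrix_pow_apply d k i j)

/-- Row `0` of `±J^k` has its only nonzero entry, `±1`, in column `k`. Distinctness is what lets the
prescribed point masses add up to a full law. -/
theorem signedPower_injective (d : ℕ) : Function.Injective (signedPower d) := by
  intro s t h
  have h0 : ∀ k : Fin d, ((⟨0, k.pos⟩ : Fin d) : ℕ) + (k : ℕ) = k := fun k => by simp
  have key : ∀ k j : Fin d, ((j : ℕ) = (((⟨0, k.pos⟩ : Fin d) : ℕ) + (k : ℕ)) % d) ↔ j = k := by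
    intro k j
    rw [h0, Nat.mod_eq_of_lt k.2, Fin.ext_iff]
  rcases s with k | k <;> rcases t with l | l
  · have h1 := congrFun (congrFun h ⟨0, k.pos⟩) k
    rw [signedPower_inl, signedPower_inl, if_pos ((key k k).2 rfl)] at h1
    by_contra hne
    rw [if_neg fun h2 => hne (by rw [(key l k).1 h2])] at h1
    norm_num at h1
  · have h1 := congrFun (congrFun h ⟨0, k.pos⟩) k
    rw [signedPower_inl, signedPower_inr, if_pos ((key k k).2 rfl)] at h1
    split_ifs at h1 <;> norm_num at h1
  · have h1 := congrFun (congrFun h ⟨0, k.pos⟩) l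
    rw [signedPower_inr, signedPower_inl] at h1
    rw [if_pos ((key l l).2 rfl)] at h1
    split_ifs at h1 <;> norm_num at h1
  · have h1 := congrFun (congrFun h ⟨0, k.pos⟩) k
    rw [signedPower_inr, signedPower_inr, if_pos ((key k k).2 rfl)] at h1
    by_contra hne
    rw [if_neg fun h2 => hne (by rw [(key l k).1 h2])] at h1
    norm_num at h1

/-- Signed powers of the shift matrix do not increase the sup norm. -/
theorem abs_signedPower_mulVec_le (d : ℕ) (s : Fin d ⊕ Fin d) {x : Fin d → ℝ}
    (hx : ∀ i, |x i| ≤ 1) (i : Fin d) : |∑ j, signedPower d s i j * x j| ≤ 1 := by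
  have hd : 0 < d := i.pos
  have key : ∀ k : Fin d, ∑ j : Fin d, (if (j : ℕ) = ((i : ℕ) + k) % d then (1 : ℝ) else 0) * x j =
      x ⟨((i : ℕ) + k) % d, Nat.mod_lt _ hd⟩ := by
    intro k
    rw [Finset.sum_eq_single ⟨((i : ℕ) + k) % d, Nat.mod_lt _ hd⟩]
    · simp
    · intro l _ hl
      rw [if_neg fun h => hl (Fin.ext h), zero_mul]
    · simp
  rcases s with k | k
  · simp only [signedPower_inl, key]
    exact hx _
  · simp only [signedPower_inr, neg_mul, Finset.sum_neg_distrib, key, abs_neg]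
    exact hx _

theorem abs_signedPower_le (d : ℕ) (s : Fin d ⊕ Fin d) (i j : Fin d) :
    |signedPower d s i j| ≤ 1 := by
  rcases s with k | k
  · rw [signedPower_inl]; split_ifs <;> simp
  · rw [signedPower_inr]; split_ifs <;> simp

/-! ### Random variables with finitely many values -/

section FiniteLaw

variable {Ω ι E : Type*} [MeasurableSpace Ω] {P : Measure Ω} [IsProbabilityMeasure P]
  [Fintype ι] [MeasurableSpace E] [MeasurableSingletonClass E] {f : Ω → E} {v : ι → E} {w : ι → ℝ}

theorem ae_exists_eq_of_sum_eq_one (hf : Measurable f) (hv : Function.Injective v)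
    (hw : ∀ i, P.real {ω | f ω = v i} = w i) (hsum : ∑ i, w i = 1) :
    ∀ᵐ ω ∂P, ∃ i, f ω = v i := by
  have hm : ∀ i, MeasurableSet {ω | f ω = v i} := fun i => hf (measurableSet_singleton (v i))
  have h1 : P.real (⋃ i, {ω | f ω = v i}) = 1 := by
    rw [measureReal_iUnion_fintype _ hm]
    · simp only [hw, hsum]
    · intro i j hij
      refine Set.disjoint_left.2 fun ω h1 h2 => hij (hv ?_)
      exact (Eq.symm h1).trans h2
  have h2 : P (⋃ i, {ω | f ω = v i}) = 1 := by
    rw [measureReal_def, ENNReal.toReal_eq_one_iff] at h1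
    exact h1
  have h3 := (prob_compl_eq_zero_iff (MeasurableSet.iUnion hm)).2 h2
  rw [ae_iff]
  refine measure_mono_null (fun ω hω => ?_) h3
  simpa using hω

/-- Almost surely `g ∘ f` is a finite combination of indicators, so `g` may be arbitrary. -/
theorem integral_eq_sum_of_sum_eq_one (hf : Measurable f) (hv : Function.Injective v)
    (hw : ∀ i, P.real {ω | f ω = v i} = w i) (hsum : ∑ i, w i = 1) (g : E → ℝ) :
    ∫ ω, g (f ω) ∂P = ∑ i, w i * g (v i) := by
  classical
  have hm : ∀ i, MeasurableSet {ω | f ω = v i} := fun i => hf (measurableSet_singleton (v i))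
  have h1 : (fun ω => g (f ω)) =ᵐ[P]
      fun ω => ∑ i, Set.indicator {ω | f ω = v i} 1 ω * g (v i) := by
    filter_upwards [ae_exists_eq_of_sum_eq_one hf hv hw hsum] with ω ⟨i, hi⟩
    rw [Finset.sum_eq_single i]
    · simp [hi]
    · intro j _ hj
      have : ω ∉ {ω | f ω = v j} := fun h => hj (hv ((Eq.symm h).trans hi))
      simp [this]
    · simp
  rw [integral_congr_ae h1, integral_finsetSum]
  · refine Finset.sum_congr rfl fun i _ => ?_
    rw [integral_mul_const, integral_indicator_one (hm i), hw]
  · intro i _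
    exact ((integrable_const (1 : ℝ)).indicator (hm i)).mul_const _

end FiniteLaw

/-! ### Laws, boundedness and one-step drift of the model -/

namespace IsModel

variable {Ω : Type*} [mΩ : MeasurableSpace Ω] {P : Measure Ω}
  {d : ℕ} {p : ℝ} {X : ℕ → Ω → (Fin d → ℝ)} {A : ℕ → Ω → Matrix (Fin d) (Fin d) ℝ}
  {β : ℕ → Ω → ℕ} {Y : ℕ → Ω → ℝ}

theorem measurable_matrix (h : IsModel P d p X A β Y) {n : ℕ} (hn : 1 ≤ n) :
    Measurable fun ω (i j : Fin d) => A (n + 1) ω i j :=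
  measurable_pi_lambda _ fun i => measurable_pi_lambda _ fun j => h.measurable_A n hn i j

theorem measurable_past (h : IsModel P d p X A β Y) (n : ℕ) :
    Measurable fun ω (k : Finset.Icc 1 n) => (X k ω, Y k ω) :=
  measurable_pi_lambda _ fun k =>
    (h.measurable_X k (Finset.mem_Icc.1 k.2).1).prodMk
      (h.measurable_Y k (Finset.mem_Icc.1 k.2).1)

/-- The law of `A (n + 1)` as weights on the signed powers. -/
noncomputable def weight (d : ℕ) (p : ℝ) : Fin d ⊕ Fin d → ℝ :=
  Sum.elim (fun i => if (i : ℕ) = 0 then p else (1 - p) / (2 * (d : ℝ) - 1))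
    fun _ => (1 - p) / (2 * (d : ℝ) - 1)

/-- The law is a constant weight `q` on all `2d` signed powers plus an excess `p - q` at the
identity. This form shows the cancellation when `g` changes sign with the matrix. -/
theorem sum_weight_mul (hd : 1 ≤ d) (g : Fin d ⊕ Fin d → ℝ) :
    ∑ s, weight d p s * g s = p * g (Sum.inl ⟨0, hd⟩)
      - (1 - p) / (2 * (d : ℝ) - 1) * g (Sum.inl ⟨0, hd⟩)
      + (1 - p) / (2 * (d : ℝ) - 1) * ∑ i, (g (Sum.inl i) + g (Sum.inr i)) := by
  set q := (1 - p) / (2 * (d : ℝ) - 1) with hq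
  have h1 : ∀ i : Fin d, weight d p (Sum.inl i) * g (Sum.inl i) =
      q * g (Sum.inl i) + if i = ⟨0, hd⟩ then (p - q) * g (Sum.inl i) else 0 := by
    intro i
    by_cases h : (i : ℕ) = 0
    · have h' : i = ⟨0, hd⟩ := Fin.ext h
      rw [if_pos h']
      simp only [weight, Sum.elim_inl, h, if_true]
      ring
    · have h' : i ≠ ⟨0, hd⟩ := fun e => h (by rw [e])
      rw [if_neg h']
      simp only [weight, Sum.elim_inl, h, if_false]
      rw [add_zero]
  rw [Fintype.sum_sum_type, Finset.sum_congr rfl fun i _ => h1 i, Finset.sum_add_distrib,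
    Finset.sum_ite_eq', if_pos (Finset.mem_univ _), Finset.sum_add_distrib, mul_add,
    Finset.mul_sum, Finset.mul_sum]
  simp only [weight, Sum.elim_inr]
  ring

theorem sum_weight (hd : 1 ≤ d) : ∑ s, weight d p s = 1 := by
  have h := sum_weight_mul (p := p) hd fun _ => 1
  have hd' : (1 : ℝ) ≤ d := by exact_mod_cast hd
  have h1 : 2 * (d : ℝ) - 1 ≠ 0 := by linarith
  simp only [mul_one, Finset.sum_const, Finset.card_univ, Fintype.card_fin, nsmul_eq_mul] at h
  rw [h]
  field_simp
  ring

theorem law_signedPower (h : IsModel P d p X A β Y) {n : ℕ} (hn : 1 ≤ n)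
    (s : Fin d ⊕ Fin d) :
    P.real {ω | (fun i j => A (n + 1) ω i j) = signedPower d s} = weight d p s := by
  have hone : ∀ k : Fin d, (k : ℕ) = 0 →
      (1 : Matrix (Fin d) (Fin d) ℝ) = shiftMatrix d ^ (k : ℕ) := fun k hk => by
    rw [hk, pow_zero]
  rcases s with k | k
  · by_cases hk : (k : ℕ) = 0
    · have := h.law_A_one n hn
      rw [hone k hk] at this
      simp only [weight, Sum.elim_inl, hk, if_true]
      exact this
    · simp only [weight, Sum.elim_inl, hk, if_false]
      exact (h.law_A_pow n hn k (by omega) k.2).1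
  · by_cases hk : (k : ℕ) = 0
    · have := h.law_A_neg_one n hn
      rw [hone k hk] at this
      exact this
    · exact (h.law_A_pow n hn k (by omega) k.2).2

/-- The filtration generated by `X 1, …, X n, Y 1, …, Y n`. -/
def pastFiltration (h : IsModel P d p X A β Y) : Filtration ℕ mΩ where
  seq n := MeasurableSpace.comap (fun ω (k : Finset.Icc 1 n) => (X k ω, Y k ω)) inferInstance
  mono' := by
    intro m n hmn
    let r : (Finset.Icc 1 n → (Fin d → ℝ) × ℝ) → Finset.Icc 1 m → (Fin d → ℝ) × ℝ :=
      fun x k => x ⟨k, Finset.Icc_subset_Icc_right hmn k.2⟩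
    have hr : Measurable r := measurable_pi_lambda _ fun k => measurable_pi_apply _
    rintro s ⟨t, ht, rfl⟩
    exact ⟨r ⁻¹' t, hr ht, rfl⟩
  le' n := (h.measurable_past n).comap_le

theorem measurable_pastFiltration (h : IsModel P d p X A β Y) {k n : ℕ} (hk : 1 ≤ k)
    (hkn : k ≤ n) : Measurable[h.pastFiltration n] fun ω => (X k ω, Y k ω) :=
  (measurable_pi_apply (⟨k, Finset.mem_Icc.2 ⟨hk, hkn⟩⟩ : Finset.Icc 1 n)).comp
      (comap_measurable fun ω (k : Finset.Icc 1 n) => (X k ω, Y k ω))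

theorem stronglyMeasurable_X (h : IsModel P d p X A β Y) {k n : ℕ} (hk : 1 ≤ k)
    (hkn : k ≤ n) (i : Fin d) : StronglyMeasurable[h.pastFiltration n] fun ω => X k ω i :=
  Measurable.stronglyMeasurable
    ((measurable_pi_apply i).comp (measurable_fst.comp (h.measurable_pastFiltration hk hkn)))

theorem stronglyMeasurable_Y (h : IsModel P d p X A β Y) {k n : ℕ} (hk : 1 ≤ k)
    (hkn : k ≤ n) : StronglyMeasurable[h.pastFiltration n] fun ω => Y k ω :=
  Measurable.stronglyMeasurable (measurable_snd.comp (h.measurable_pastFiltration hk hkn))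

variable [IsProbabilityMeasure P]

theorem ae_exists_signedPower (h : IsModel P d p X A β Y) (hd : 1 ≤ d) {n : ℕ} (hn : 1 ≤ n) :
    ∀ᵐ ω ∂P, ∃ s, (fun i j => A (n + 1) ω i j) = signedPower d s :=
  ae_exists_eq_of_sum_eq_one (h.measurable_matrix hn) (signedPower_injective d)
    (h.law_signedPower hn) (sum_weight hd)

theorem integral_matrix (h : IsModel P d p X A β Y) (hd : 1 ≤ d)
    (hp : p = (2 * (d : ℝ) + 1) / (4 * (d : ℝ))) {n : ℕ} (hn : 1 ≤ n) (i j : Fin d) :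
    ∫ ω, A (n + 1) ω i j ∂P = if j = i then 1 / 2 else 0 := by
  have h1 : ∫ ω, A (n + 1) ω i j ∂P = ∑ s, weight d p s * signedPower d s i j :=
    integral_eq_sum_of_sum_eq_one (h.measurable_matrix hn) (signedPower_injective d)
      (h.law_signedPower hn) (sum_weight hd) fun M => M i j
  have hd' : (1 : ℝ) ≤ d := by exact_mod_cast hd
  have hd1 : 2 * (d : ℝ) - 1 ≠ 0 := by linarith
  -- The critical value of `p` enters here.
  have hpq : p - (1 - p) / (2 * (d : ℝ) - 1) = 1 / 2 := by
    rw [hp]; field_simp; ring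
  rw [h1, sum_weight_mul hd]
  simp only [signedPower_inl, signedPower_inr, add_neg_cancel, Finset.sum_const_zero, mul_zero,
    add_zero, Nat.mod_eq_of_lt i.2, ← Fin.ext_iff]
  rw [← sub_mul, hpq]
  split_ifs <;> simp

theorem ae_recall_mem (h : IsModel P d p X A β Y) {n : ℕ} (hn : 1 ≤ n) :
    ∀ᵐ ω ∂P, β n ω ∈ Finset.Icc 1 n := by
  have hn' : (n : ℝ) ≠ 0 := by positivity
  have := ae_exists_eq_of_sum_eq_one (P := P) (ι := Finset.Icc 1 n) (v := fun k => (k : ℕ))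
    (w := fun _ => 1 / (n : ℝ)) (h.measurable_β n hn) Subtype.val_injective
    (fun k => h.law_β n hn k k.2) (by simp [hn'])
  filter_upwards [this] with ω ⟨k, hk⟩
  rw [hk]; exact k.2

theorem ae_abs_X_one_le (h : IsModel P d p X A β Y) (hd : 1 ≤ d) :
    ∀ᵐ ω ∂P, ∀ i, |X 1 ω i| ≤ 1 := by
  have hd' : (d : ℝ) ≠ 0 := by positivity
  have hinj : Function.Injective (Sum.elim (fun i : Fin d => (Pi.single i 1 : Fin d → ℝ))
      fun i => -Pi.single i 1) := by
    rintro (k | k) (l | l) hkl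
    · have := congrFun hkl k
      by_contra hne
      have hne' : k ≠ l := fun e => hne (by rw [e])
      simp [hne'] at this
    · have := congrFun hkl k
      simp only [Sum.elim_inl, Sum.elim_inr, Pi.single_apply, Pi.neg_apply] at this
      split_ifs at this <;> norm_num at this
    · have := congrFun hkl l
      simp only [Sum.elim_inl, Sum.elim_inr, Pi.single_apply, Pi.neg_apply] at this
      split_ifs at this <;> norm_num at this
    · have := congrFun hkl k
      by_contra hne
      have hne' : k ≠ l := fun e => hne (by rw [e])
      simp [hne'] at this
  have := ae_exists_eq_of_sum_eq_one (P := P) (w := fun _ => 1 / (2 * (d : ℝ)))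
    (h.measurable_X 1 le_rfl) hinj
    (by rintro (k | k); exacts [(h.law_X_one k).1, (h.law_X_one k).2])
    (by simp; field_simp; norm_num)
  filter_upwards [this] with ω ⟨k, hk⟩ i
  rw [hk]
  rcases k with k | k
  · simp only [Sum.elim_inl, Pi.single_apply]; split_ifs <;> simp
  · simp only [Sum.elim_inr, Pi.single_apply, Pi.neg_apply]; split_ifs <;> simp

/-- Each new direction is a signed cyclic shift of an earlier one. The exceptional null sets for all
`n` are discarded first, so that the strong induction runs at a fixed `ω`. -/
theorem ae_abs_X_le (h : IsModel P d p X A β Y) (hd : 1 ≤ d) :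
    ∀ᵐ ω ∂P, ∀ n, 1 ≤ n → ∀ i, |X n ω i| ≤ 1 := by
  have hX : ∀ᵐ ω ∂P, ∀ n, 1 ≤ n → X (n + 1) ω = A (n + 1) ω *ᵥ X (β n ω) ω :=
    ae_all_iff.2 fun n => by
      by_cases hn : 1 ≤ n
      · filter_upwards [h.X_succ n hn] with ω hω _ using hω
      · exact Eventually.of_forall fun ω hn' => absurd hn' hn
  have hβ : ∀ᵐ ω ∂P, ∀ n, 1 ≤ n → β n ω ∈ Finset.Icc 1 n :=
    ae_all_iff.2 fun n => by
      by_cases hn : 1 ≤ n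
      · filter_upwards [h.ae_recall_mem hn] with ω hω _ using hω
      · exact Eventually.of_forall fun ω hn' => absurd hn' hn
  have hA : ∀ᵐ ω ∂P, ∀ n, 1 ≤ n → ∃ s, (fun i j => A (n + 1) ω i j) = signedPower d s :=
    ae_all_iff.2 fun n => by
      by_cases hn : 1 ≤ n
      · filter_upwards [h.ae_exists_signedPower hd hn] with ω hω _ using hω
      · exact Eventually.of_forall fun ω hn' => absurd hn' hn
  filter_upwards [hX, hβ, hA, h.ae_abs_X_one_le hd] with ω hX hβ hA h1 n
  induction n using Nat.strong_induction_on with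
  | _ n ih =>
    intro hn i
    obtain rfl | ⟨m, hm, rfl⟩ : n = 1 ∨ ∃ m, 1 ≤ m ∧ n = m + 1 := by
      rcases Nat.lt_or_ge 1 n with h2 | h2
      · exact Or.inr ⟨n - 1, by omega, by omega⟩
      · exact Or.inl (by omega)
    · exact h1 i
    · obtain ⟨s, hs⟩ := hA m hm
      have hb := Finset.mem_Icc.1 (hβ m hm)
      rw [hX m hm]
      have h2 : (A (m + 1) ω *ᵥ X (β m ω) ω) i = ∑ j, signedPower d s i j * X (β m ω) ω j := by
        rw [← hs]; rfl
      rw [h2]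
      exact abs_signedPower_mulVec_le d s (ih _ (by omega) hb.1) i

/-- The innovation at time `n + 1` is independent of the past. -/
theorem condExp_innovation (h : IsModel P d p X A β Y) {n : ℕ} (hn : 1 ≤ n)
    {φ : (Fin d → Fin d → ℝ) × ℕ × ℝ → ℝ} (hφ : Measurable φ) :
    P[fun ω => φ (fun i j => A (n + 1) ω i j, β n ω, Y (n + 1) ω) | h.pastFiltration n] =ᵐ[P]
      fun _ => ∫ ω, φ (fun i j => A (n + 1) ω i j, β n ω, Y (n + 1) ω) ∂P := by
  have hm : Measurable fun ω => ((fun i j : Fin d => A (n + 1) ω i j), β n ω, Y (n + 1) ω) :=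
    (h.measurable_matrix hn).prodMk
      ((h.measurable_β n hn).prodMk (h.measurable_Y (n + 1) (by omega)))
  exact condExp_indep_eq hm.comap_le (h.pastFiltration.le n)
    (hφ.comp (comap_measurable _)).stronglyMeasurable
    ((IndepFun_iff_Indep _ _ _).1 (h.indep_past n hn))

/-- The product of the recall indicator, a matrix entry and a function of the step size. -/
theorem integral_innovation (h : IsModel P d p X A β Y) (hd : 1 ≤ d)
    (hp : p = (2 * (d : ℝ) + 1) / (4 * (d : ℝ))) {n : ℕ} (hn : 1 ≤ n) {ψ : ℝ → ℝ}
    (hψ : Measurable ψ) {k : ℕ} (hk : k ∈ Finset.Icc 1 n) (i j : Fin d) :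
    ∫ ω, A (n + 1) ω i j * ({k} : Set ℕ).indicator 1 (β n ω) * ψ (Y (n + 1) ω) ∂P =
      (if j = i then 1 / 2 else 0) * (1 / (n : ℝ)) * ∫ ω, ψ (Y (n + 1) ω) ∂P := by
  have hent : Measurable fun M : Fin d → Fin d → ℝ => M i j :=
    (measurable_pi_apply j).comp (measurable_pi_apply i)
  have hind : Measurable (({k} : Set ℕ).indicator (1 : ℕ → ℝ)) := measurable_from_top
  have i1 : IndepFun (fun ω => A (n + 1) ω i j)
      (fun ω => ({k} : Set ℕ).indicator (1 : ℕ → ℝ) (β n ω)) P :=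
    (h.indep_A_β n hn).comp hent hind
  have i2 : IndepFun (fun ω => A (n + 1) ω i j * ({k} : Set ℕ).indicator (1 : ℕ → ℝ) (β n ω))
      (fun ω => ψ (Y (n + 1) ω)) P :=
    (h.indep_Aβ_Y n hn).comp ((hent.comp measurable_fst).mul (hind.comp measurable_snd)) hψ
  have m1 : Measurable fun ω => ({k} : Set ℕ).indicator (1 : ℕ → ℝ) (β n ω) :=
    hind.comp (h.measurable_β n hn)
  have hβ : ∫ ω, ({k} : Set ℕ).indicator (1 : ℕ → ℝ) (β n ω) ∂P = 1 / (n : ℝ) := by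
    rw [← h.law_β n hn k hk, ← integral_indicator_one]
    · refine integral_congr_ae (Eventually.of_forall fun ω => ?_)
      simp [Set.indicator_apply]
    · exact h.measurable_β n hn (measurableSet_singleton k)
  rw [i2.integral_fun_mul_eq_mul_integral
    ((h.measurable_A n hn i j).mul m1).aestronglyMeasurable
    (hψ.comp (h.measurable_Y (n + 1) (by omega))).aestronglyMeasurable,
    i1.integral_fun_mul_eq_mul_integral (h.measurable_A n hn i j).aestronglyMeasurable
    m1.aestronglyMeasurable, h.integral_matrix hd hp hn, hβ]

/-- The drift: the next direction, weighted by a function of the next step size. -/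
theorem condExp_weighted_X (h : IsModel P d p X A β Y) (hd : 1 ≤ d)
    (hp : p = (2 * (d : ℝ) + 1) / (4 * (d : ℝ))) {n : ℕ} (hn : 1 ≤ n) {ψ : ℝ → ℝ}
    (hψ : Measurable ψ) (hint : Integrable (fun ω => ψ (Y (n + 1) ω)) P) (i : Fin d) :
    P[fun ω => ψ (Y (n + 1) ω) * X (n + 1) ω i | h.pastFiltration n] =ᵐ[P]
      fun ω => (∫ ω, ψ (Y (n + 1) ω) ∂P) * (1 / (2 * (n : ℝ)) *
        ∑ k ∈ Finset.Icc 1 n, X k ω i) := by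
  -- Splitting over the value of `β n` replaces the random index by fixed times: the weighted
  -- direction becomes `∑ W k j * V k j`, with `W` a function of the innovation and `V` of the past.
  set W : ℕ → Fin d → Ω → ℝ := fun k j ω =>
    A (n + 1) ω i j * ({k} : Set ℕ).indicator 1 (β n ω) * ψ (Y (n + 1) ω) with hW
  set V : ℕ → Fin d → Ω → ℝ := fun k j ω => X k ω j with hV
  have hind : ∀ k, Measurable (({k} : Set ℕ).indicator (1 : ℕ → ℝ)) := fun k => measurable_from_top
  have hWint : ∀ k j, Integrable (W k j) P := by
    intro k j
    refine Integrable.bdd_mul (c := 1) hint ((h.measurable_A n hn i j).mul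
      ((hind k).comp (h.measurable_β n hn))).aestronglyMeasurable ?_
    filter_upwards [h.ae_exists_signedPower hd hn] with ω ⟨s, hs⟩
    have h1 : |A (n + 1) ω i j| ≤ 1 := by
      have := abs_signedPower_le d s i j
      rwa [← hs] at this
    simp only [Set.indicator_apply]
    split_ifs
    · simpa using h1
    · simp
  have hVmeas : ∀ k ∈ Finset.Icc 1 n, ∀ j, StronglyMeasurable[h.pastFiltration n] (V k j) := by
    intro k hk j
    have := Finset.mem_Icc.1 hk
    exact h.stronglyMeasurable_X this.1 this.2 j
  have hWV : ∀ k ∈ Finset.Icc 1 n, ∀ j, Integrable (W k j * V k j) P := by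
    intro k hk j
    refine Integrable.mul_bdd (c := 1) (hWint k j)
      ((hVmeas k hk j).mono (h.pastFiltration.le n)).aestronglyMeasurable ?_
    filter_upwards [h.ae_abs_X_le hd] with ω hω
    exact hω k (Finset.mem_Icc.1 hk).1 j
  have hpoint : (fun ω => ψ (Y (n + 1) ω) * X (n + 1) ω i) =ᵐ[P]
      ∑ k ∈ Finset.Icc 1 n, ∑ j, W k j * V k j := by
    filter_upwards [h.X_succ n hn, h.ae_recall_mem hn] with ω hX hβ
    rw [Finset.sum_apply, Finset.sum_eq_single (β n ω)]
    · rw [hX, Finset.sum_apply]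
      simp only [Matrix.mulVec, dotProduct, Finset.mul_sum]
      refine Finset.sum_congr rfl fun j _ => ?_
      simp only [hW, hV, Pi.mul_apply, Set.indicator_apply, Set.mem_singleton_iff, if_true,
        Pi.one_apply]
      ring
    · intro k _ hk
      rw [Finset.sum_apply]
      refine Finset.sum_eq_zero fun j _ => ?_
      simp [hW, Set.indicator_apply, hk.symm]
    · intro h'; exact absurd hβ h'
  -- The past factor `V` comes out, and `W`, independent of the past, is replaced by its mean.
  have hterm : ∀ k ∈ Finset.Icc 1 n, ∀ j, P[W k j * V k j | h.pastFiltration n] =ᵐ[P]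
      fun ω => (if j = i then 1 / 2 else 0) * (1 / (n : ℝ)) *
        (∫ ω, ψ (Y (n + 1) ω) ∂P) * V k j ω := by
    intro k hk j
    have h1 := condExp_mul_of_aestronglyMeasurable_right
      (hVmeas k hk j).aestronglyMeasurable (hWV k hk j) (hWint k j)
    have hent : Measurable fun t : (Fin d → Fin d → ℝ) × ℕ × ℝ => t.1 i j :=
      (measurable_pi_apply j).comp ((measurable_pi_apply i).comp measurable_fst)
    have h2 := h.condExp_innovation hn (φ := fun t => t.1 i j *
      ({k} : Set ℕ).indicator 1 t.2.1 * ψ t.2.2)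
      ((hent.mul ((hind k).comp (measurable_fst.comp measurable_snd))).mul
        (hψ.comp (measurable_snd.comp measurable_snd)))
    filter_upwards [h1, h2] with ω h1 h2
    rw [h1, Pi.mul_apply]
    congr 1
    exact h2.trans (h.integral_innovation hd hp hn hψ hk i j)
  refine (condExp_congr_ae hpoint).trans ?_
  refine (condExp_finsetSum (fun k hk => integrable_finsetSum' _ fun j _ => hWV k hk j) _).trans ?_
  have hinner : ∀ k ∈ Finset.Icc 1 n, P[∑ j, W k j * V k j | h.pastFiltration n] =ᵐ[P]
      fun ω => 1 / 2 * (1 / (n : ℝ)) * (∫ ω, ψ (Y (n + 1) ω) ∂P) * X k ω i := by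
    intro k hk
    refine (condExp_finsetSum (fun j _ => hWV k hk j) _).trans ?_
    have h1 : ∀ᵐ ω ∂P, ∀ j, (P[W k j * V k j | h.pastFiltration n]) ω =
        (if j = i then 1 / 2 else 0) * (1 / (n : ℝ)) * (∫ ω, ψ (Y (n + 1) ω) ∂P) * V k j ω :=
      ae_all_iff.2 fun j => hterm k hk j
    filter_upwards [h1] with ω h1
    rw [Finset.sum_apply, Finset.sum_congr rfl fun j _ => h1 j, Finset.sum_eq_single i]
    · simp [hV]
    · intro j _ hj; simp [hj]
    · simp
  have hall : ∀ᵐ ω ∂P, ∀ k : Finset.Icc 1 n,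
      (P[∑ j, W k j * V k j | h.pastFiltration n]) ω =
        1 / 2 * (1 / (n : ℝ)) * (∫ ω, ψ (Y (n + 1) ω) ∂P) * X k ω i :=
    ae_all_iff.2 fun k => hinner k k.2
  filter_upwards [hall] with ω hω
  have hω' : ∀ k ∈ Finset.Icc 1 n, (P[∑ j, W k j * V k j | h.pastFiltration n]) ω =
      1 / 2 * (1 / (n : ℝ)) * (∫ ω, ψ (Y (n + 1) ω) ∂P) * X k ω i := fun k hk => hω ⟨k, hk⟩
  rw [Finset.sum_apply, Finset.sum_congr rfl hω', ← Finset.mul_sum]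
  have : (n : ℝ) ≠ 0 := by positivity
  field_simp

end IsModel

/-! ### The logarithmic norming -/

/-- The norming `(1 + log (n + 1)) ^ α`. -/
noncomputable def logNorm (α : ℝ) (n : ℕ) : ℝ := (1 + Real.log ((n : ℝ) + 1)) ^ α

theorem log_add_one_nonneg (n : ℕ) : 0 ≤ Real.log ((n : ℝ) + 1) :=
  Real.log_nonneg (by linarith [(Nat.cast_nonneg n : (0 : ℝ) ≤ n)])

theorem logNorm_pos (α : ℝ) (n : ℕ) : 0 < logNorm α n :=
  Real.rpow_pos_of_pos (by linarith [log_add_one_nonneg n]) α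

theorem logNorm_mono {α : ℝ} (hα : 0 ≤ α) : Monotone (logNorm α) := by
  intro m n hmn
  have h1 : (m : ℝ) ≤ n := by exact_mod_cast hmn
  have h2 : Real.log ((m : ℝ) + 1) ≤ Real.log ((n : ℝ) + 1) :=
    Real.log_le_log (by positivity) (by linarith)
  exact Real.rpow_le_rpow (by linarith [log_add_one_nonneg m]) (by linarith) hα

theorem tendsto_logNorm {α : ℝ} (hα : 0 < α) : Tendsto (logNorm α) atTop atTop := by
  refine (tendsto_rpow_atTop hα).comp (tendsto_atTop_add_const_left _ _ ?_)
  exact Real.tendsto_log_atTop.comp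
    (tendsto_atTop_add_const_right _ _ tendsto_natCast_atTop_atTop)

theorem logNorm_sq (α : ℝ) (n : ℕ) :
    logNorm α n ^ 2 = (1 + Real.log ((n : ℝ) + 1)) ^ (2 * α) := by
  rw [logNorm, ← Real.rpow_natCast, ← Real.rpow_mul (by linarith [log_add_one_nonneg n])]
  push_cast
  rw [mul_comm]

/-- The squared norming has exponent `2α`, so `α > 1/2` is what gives convergence. -/
theorem summable_logNorm {α : ℝ} (hα : 1 / 2 < α) (C : ℝ) :
    Summable fun n : ℕ => C / ((n : ℝ) + 1) / logNorm α n ^ 2 := by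
  refine ((summable_inv_mul_one_add_log_rpow (s := 2 * α) (by linarith)).mul_left C).congr
    fun n => ?_
  rw [logNorm_sq, div_div, mul_one_div]

/-- For `n ≥ 3`, `1 ≤ log n` and `n + 1 ≤ n²`, hence `1 + log (n+1) ≤ 3 log n`. This serves to
return from the everywhere positive norming to `(log n)^α`. -/
theorem logNorm_le {α : ℝ} (hα : 0 ≤ α) {n : ℕ} (hn : 3 ≤ n) :
    logNorm α n ≤ 3 ^ α * Real.log n ^ α := by
  have hn' : (3 : ℝ) ≤ n := by exact_mod_cast hn
  have hl : 1 ≤ Real.log n := by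
    rw [Real.le_log_iff_exp_le (by linarith)]
    linarith [Real.exp_one_lt_d9]
  have h1 : Real.log ((n : ℝ) + 1) ≤ 2 * Real.log n := by
    rw [← Real.log_rpow (by linarith)]
    refine Real.log_le_log (by linarith) ?_
    norm_num
    nlinarith
  rw [← Real.mul_rpow (by norm_num) (by linarith)]
  exact Real.rpow_le_rpow (by linarith [log_add_one_nonneg n]) (by linarith) hα

theorem inv_damping_mul_sqrt_le {n : ℕ} (hn : 1 ≤ n) :
    (damping n * Real.sqrt ((n : ℝ) + 1))⁻¹ ≤ 2 := by
  obtain ⟨m, rfl⟩ : ∃ m, n = m + 1 := ⟨n - 1, by omega⟩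
  have h1 := le_damping_sq m
  have h2 : 0 < 1 / ((m : ℝ) + 1) := by positivity
  have h3 : 1 / 2 ≤ damping (m + 1) * Real.sqrt (((m + 1 : ℕ) : ℝ) + 1) := by
    refine (sq_le_sq₀ (by norm_num) (mul_nonneg (damping_pos _).le (Real.sqrt_nonneg _))).1 ?_
    rw [mul_pow, Real.sq_sqrt (by positivity)]
    push_cast
    nlinarith [sq_nonneg (damping (m + 1))]
  calc _ ≤ (1 / 2 : ℝ)⁻¹ := inv_anti₀ (by norm_num) h3
    _ = 2 := by norm_num

/-! ### The two martingales and the conclusion -/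

namespace IsModel

variable {Ω : Type*} [mΩ : MeasurableSpace Ω] {P : Measure Ω}
  {d : ℕ} {p : ℝ} {X : ℕ → Ω → (Fin d → ℝ)} {A : ℕ → Ω → Matrix (Fin d) (Fin d) ℝ}
  {β : ℕ → Ω → ℕ} {Y : ℕ → Ω → ℝ}

theorem ae_step_eq (h : IsModel P d p X A β Y) :
    ∀ᵐ ω ∂P, ∀ n, 1 ≤ n → step X A β Y n ω = Y n ω • X n ω := by
  refine ae_all_iff.2 fun n => ?_
  match n with
  | 0 => exact Eventually.of_forall fun ω hn => absurd hn (by omega)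
  | 1 => exact Eventually.of_forall fun ω _ => rfl
  | n + 2 =>
    filter_upwards [h.X_succ (n + 1) (by omega)] with ω hω _
    rw [hω]
    rfl

variable [IsProbabilityMeasure P]

/-- The walk with unit steps is `o(√n (log n) ^ α)`, in terms of the martingale
`damping n * ∑ k ≤ n, X k`. -/
theorem ae_tendsto_damping_mul_sum_X (h : IsModel P d p X A β Y) (hd : 1 ≤ d)
    (hp : p = (2 * (d : ℝ) + 1) / (4 * (d : ℝ))) {α : ℝ} (hα : 1 / 2 < α) (i : Fin d) :
    ∀ᵐ ω ∂P, Tendsto (fun n => damping n * (∑ k ∈ Finset.Icc 1 n, X k ω i) / logNorm α n)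
      atTop (𝓝 0) := by
  set Z : ℕ → Ω → ℝ := fun n ω => 1 / (2 * (n : ℝ)) * ∑ k ∈ Finset.Icc 1 n, X k ω i with hZ
  set D : ℕ → Ω → ℝ := fun k ω => damping (k + 1) * (X (k + 1) ω i - Z k ω) with hD
  have hsum : ∀ n ω, ∑ k ∈ Finset.range n, D k ω =
      damping n * ∑ k ∈ Finset.Icc 1 n, X k ω i := by
    intro n ω
    -- The drift term `Z n` is what the change from `damping n` to `damping (n+1)` absorbs; `Z 0 =
    -- 0` by convention.
    induction n with
    | zero => simp
    | succ n ih =>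
      have h1 : damping n = damping (n + 1) * (1 + 1 / (2 * (n : ℝ))) := by
        rw [damping, div_mul_cancel₀ _ (by positivity)]
      rw [Finset.sum_range_succ, ih, Finset.sum_Icc_succ_top (by omega)]
      simp only [hD, hZ]
      rw [h1]
      ring
  have hZmeas : ∀ k, StronglyMeasurable[h.pastFiltration k] (Z k) := fun k =>
    (Finset.stronglyMeasurable_fun_sum _ fun l hl =>
      h.stronglyMeasurable_X (Finset.mem_Icc.1 hl).1 (Finset.mem_Icc.1 hl).2 i).const_mul _
  have hDmeas : ∀ k, StronglyMeasurable[h.pastFiltration (k + 1)] (D k) := fun k =>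
    ((h.stronglyMeasurable_X (by omega) le_rfl i).sub
      ((hZmeas k).mono (h.pastFiltration.mono k.le_succ))).const_mul _
  have hZle : ∀ᵐ ω ∂P, ∀ k, |Z k ω| ≤ 1 := by
    filter_upwards [h.ae_abs_X_le hd] with ω hω k
    have h1 : |∑ l ∈ Finset.Icc 1 k, X l ω i| ≤ k := by
      refine (Finset.abs_sum_le_sum_abs _ _).trans ?_
      refine (Finset.sum_le_sum fun l hl => hω l (Finset.mem_Icc.1 hl).1 i).trans ?_
      simp
    have h2 : (0 : ℝ) ≤ 1 / (2 * (k : ℝ)) := by positivity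
    rw [hZ, abs_mul, abs_of_nonneg h2]
    refine (mul_le_mul_of_nonneg_left h1 h2).trans ?_
    rcases Nat.eq_zero_or_pos k with rfl | hk
    · simp
    · have : (k : ℝ) ≠ 0 := by positivity
      field_simp
      norm_num
  have hDle : ∀ᵐ ω ∂P, ∀ k, |D k ω| ≤ damping (k + 1) * 2 := by
    filter_upwards [h.ae_abs_X_le hd, hZle] with ω hω hZω k
    rw [hD, abs_mul, abs_of_pos (damping_pos _)]
    refine mul_le_mul_of_nonneg_left ((abs_sub _ _).trans ?_) (damping_pos _).le
    linarith [hω (k + 1) (by omega) i, hZω k]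
  have hXint : ∀ k, Integrable (fun ω => X (k + 1) ω i) P := fun k =>
    Integrable.of_bound ((h.stronglyMeasurable_X (by omega) le_rfl i).mono
      (h.pastFiltration.le (k + 1))).aestronglyMeasurable 1 (by
        filter_upwards [h.ae_abs_X_le hd] with ω hω using hω (k + 1) (by omega) i)
  have hZint : ∀ k, Integrable (Z k) P := fun k =>
    Integrable.of_bound ((hZmeas k).mono (h.pastFiltration.le k)).aestronglyMeasurable 1 (by
        filter_upwards [hZle] with ω hω using hω k)
  have hDL2 : ∀ k, MemLp (D k) 2 P := fun k =>
    MemLp.of_bound ((hDmeas k).mono (h.pastFiltration.le (k + 1))).aestronglyMeasurable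
      (damping (k + 1) * 2) (by filter_upwards [hDle] with ω hω using hω k)
  have hzero : ∀ k, 1 ≤ k → P[D k | h.pastFiltration k] =ᵐ[P] 0 := by
    intro k hk
    have h1 := h.condExp_weighted_X hd hp hk (ψ := fun _ => 1) measurable_const
      (integrable_const 1) i
    have h2 : P[fun ω => X (k + 1) ω i | h.pastFiltration k] =ᵐ[P] Z k := by
      simpa only [one_mul, integral_const, probReal_univ, smul_eq_mul, mul_one] using h1
    have h3 : D k = damping (k + 1) • ((fun ω => X (k + 1) ω i) - Z k) := rfl
    rw [h3]
    refine (condExp_smul _ _ _).trans ?_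
    filter_upwards [condExp_sub (hXint k) (hZint k) (h.pastFiltration k), h2] with ω h4 h5
    rw [Pi.smul_apply, h4, Pi.sub_apply, h5,
      condExp_of_stronglyMeasurable (h.pastFiltration.le k) (hZmeas k) (hZint k)]
    simp
  -- Here `4 = 2²`, from `|X| + |Z| ≤ 2` and `damping_sq_le`.
  have hc : ∀ k, ∫ ω, D k ω ^ 2 ∂P ≤ 4 / ((k : ℝ) + 1) := by
    intro k
    have h1 : ∫ ω, D k ω ^ 2 ∂P ≤ ∫ _, 4 / ((k : ℝ) + 1) ∂P := by
      refine integral_mono_ae (hDL2 k).integrable_sq (integrable_const _) ?_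
      filter_upwards [hDle] with ω hω
      rw [← sq_abs]
      have h2 := pow_le_pow_left₀ (abs_nonneg _) (hω k) 2
      have h3 := damping_sq_le k
      refine h2.trans ?_
      rw [mul_pow, show (4 : ℝ) / ((k : ℝ) + 1) = 1 / ((k : ℝ) + 1) * 2 ^ 2 by ring]
      gcongr
    simpa using h1
  have := ae_tendsto_sum_div_of_condExp_eq_zero h.pastFiltration (logNorm_pos α)
    (logNorm_mono (by linarith)) (tendsto_logNorm (by linarith)) (fun k _ => hDmeas k)
    (fun k _ => hDL2 k) hzero (fun k _ => hc k) (summable_logNorm hα 4)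
  simpa only [hsum] using this

/-- The centred step sizes contribute `o(√n (log n) ^ α)`. -/
theorem ae_tendsto_sum_centred (h : IsModel P d p X A β Y) (hd : 1 ≤ d)
    (hp : p = (2 * (d : ℝ) + 1) / (4 * (d : ℝ))) {α : ℝ} (hα : 1 / 2 < α) (i : Fin d) :
    ∀ᵐ ω ∂P, Tendsto (fun n : ℕ => (∑ k ∈ Finset.Icc 1 n, (Y k ω - ∫ ω, Y 2 ω ∂P) * X k ω i) /
      (Real.sqrt ((n : ℝ) + 1) * logNorm α n)) atTop (𝓝 0) := by
  set μ := ∫ ω, Y 2 ω ∂P with hμ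
  set D : ℕ → Ω → ℝ := fun k ω => (Y (k + 1) ω - μ) * X (k + 1) ω i with hD
  have hsum : ∀ n ω, ∑ k ∈ Finset.range n, D k ω =
      ∑ k ∈ Finset.Icc 1 n, (Y k ω - μ) * X k ω i := by
    intro n ω
    induction n with
    | zero => simp
    | succ n ih => rw [Finset.sum_range_succ, ih, Finset.sum_Icc_succ_top (by omega)]
  have hcent : ∀ k, MemLp (fun ω => Y (k + 1) ω - μ) 2 P := fun k =>
    (h.memLp_Y (k + 1) (by omega)).sub (memLp_const μ)
  have hDmeas : ∀ k, StronglyMeasurable[h.pastFiltration (k + 1)] (D k) := fun k =>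
    ((h.stronglyMeasurable_Y (by omega) le_rfl).sub stronglyMeasurable_const).mul
      (h.stronglyMeasurable_X (by omega) le_rfl i)
  have hDle : ∀ᵐ ω ∂P, ∀ k, |D k ω| ≤ |Y (k + 1) ω - μ| := by
    filter_upwards [h.ae_abs_X_le hd] with ω hω k
    rw [hD, abs_mul]
    exact mul_le_of_le_one_right (abs_nonneg _) (hω (k + 1) (by omega) i)
  have hDL2 : ∀ k, MemLp (D k) 2 P := fun k =>
    (hcent k).of_le ((hDmeas k).mono (h.pastFiltration.le (k + 1))).aestronglyMeasurable (by
      filter_upwards [hDle] with ω hω using hω k)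
  have hzero : ∀ k, 1 ≤ k → P[D k | h.pastFiltration k] =ᵐ[P] 0 := by
    intro k hk
    -- Since `k + 1 ≥ 2`, the mean is `μ`; taking `ψ y = y - μ` in the drift formula then gives
    -- zero. The law of `Y 1` may differ, which is why `k = 0` is excluded.
    have h0 : ∫ ω, (Y (k + 1) ω - μ) ∂P = 0 := by
      rw [integral_sub ((h.memLp_Y (k + 1) (by omega)).integrable (by norm_num))
        (integrable_const μ), (h.identDistrib_Y (k + 1) (by omega)).integral_eq]
      simp [hμ]
    have h1 := h.condExp_weighted_X hd hp hk (ψ := fun y => y - μ)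
      (measurable_id.sub_const μ) ((hcent k).integrable (by norm_num)) i
    simp only [h0, zero_mul] at h1
    exact h1
  have hc : ∀ k, 1 ≤ k → ∫ ω, D k ω ^ 2 ∂P ≤ ∫ ω, (Y 2 ω - μ) ^ 2 ∂P := by
    intro k hk
    have h1 : ∫ ω, (Y (k + 1) ω - μ) ^ 2 ∂P = ∫ ω, (Y 2 ω - μ) ^ 2 ∂P :=
      ((h.identDistrib_Y (k + 1) (by omega)).comp
        (u := fun y => (y - μ) ^ 2) ((measurable_id.sub_const μ).pow_const 2)).integral_eq
    rw [← h1]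
    refine integral_mono_ae (hDL2 k).integrable_sq (hcent k).integrable_sq ?_
    filter_upwards [hDle] with ω hω
    exact sq_le_sq.2 (hω k)
  have hsqrt : Monotone fun n : ℕ => Real.sqrt ((n : ℝ) + 1) := by
    intro m n hmn
    have h1 : (m : ℝ) ≤ n := by exact_mod_cast hmn
    exact Real.sqrt_le_sqrt (by linarith)
  have hsqrt_top : Tendsto (fun n : ℕ => Real.sqrt ((n : ℝ) + 1)) atTop atTop :=
    Real.tendsto_sqrt_atTop.comp
      (tendsto_atTop_add_const_right _ _ tendsto_natCast_atTop_atTop)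
  have := ae_tendsto_sum_div_of_condExp_eq_zero h.pastFiltration
    (b := fun n : ℕ => Real.sqrt ((n : ℝ) + 1) * logNorm α n)
    (fun n => mul_pos (Real.sqrt_pos.2 (by positivity)) (logNorm_pos α n))
    (fun m n hmn => mul_le_mul (hsqrt hmn) (logNorm_mono (by linarith) hmn)
      (logNorm_pos α m).le (Real.sqrt_nonneg _))
    (hsqrt_top.atTop_mul_atTop₀ (tendsto_logNorm (by linarith))) (fun k _ => hDmeas k)
    (fun k _ => hDL2 k) hzero hc
    ((summable_logNorm hα (∫ ω, (Y 2 ω - μ) ^ 2 ∂P)).congr fun n => by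
      rw [mul_pow, Real.sq_sqrt (by positivity), div_div])
  simpa only [hsum] using this

theorem ae_tendsto_position_apply (h : IsModel P d p X A β Y) (hd : 1 ≤ d)
    (hp : p = (2 * (d : ℝ) + 1) / (4 * (d : ℝ))) {α : ℝ} (hα : 1 / 2 < α) (i : Fin d) :
    ∀ᵐ ω ∂P, Tendsto
      (fun n : ℕ => (Real.sqrt (n : ℝ) * Real.log (n : ℝ) ^ α)⁻¹ * position X A β Y n ω i)
      atTop (𝓝 0) := by
  filter_upwards [h.ae_tendsto_damping_mul_sum_X hd hp hα i,
    h.ae_tendsto_sum_centred hd hp hα i, h.ae_step_eq] with ω hX hY hstep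
  set μ := ∫ ω, Y 2 ω ∂P
  have hpos : ∀ n, position X A β Y n ω i = (∑ k ∈ Finset.Icc 1 n, (Y k ω - μ) * X k ω i) +
      μ * ∑ k ∈ Finset.Icc 1 n, X k ω i := by
    intro n
    rw [position, Finset.sum_apply, Finset.mul_sum, ← Finset.sum_add_distrib]
    refine Finset.sum_congr rfl fun k hk => ?_
    rw [hstep k (Finset.mem_Icc.1 hk).1, Pi.smul_apply, smul_eq_mul]
    ring
  have hZ : Tendsto (fun n : ℕ => (∑ k ∈ Finset.Icc 1 n, X k ω i) /
      (Real.sqrt ((n : ℝ) + 1) * logNorm α n)) atTop (𝓝 0) := by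
    -- A bounded ratio of normings suffices, since the limit is zero; the same argument gives
    -- `hratio` its use below.
    have hbdd : ∀ᶠ n : ℕ in atTop, ‖(damping n * Real.sqrt ((n : ℝ) + 1))⁻¹‖ ≤ 2 := by
      filter_upwards [eventually_ge_atTop 1] with n hn
      rw [Real.norm_of_nonneg (inv_nonneg.2 (mul_nonneg (damping_pos n).le (Real.sqrt_nonneg _)))]
      exact inv_damping_mul_sqrt_le hn
    refine (hX.zero_mul_isBoundedUnder_le (isBoundedUnder_of_eventually_le hbdd)).congr
      fun n => ?_
    have h1 := (damping_pos n).ne'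
    have h2 := (logNorm_pos α n).ne'
    have h3 : Real.sqrt ((n : ℝ) + 1) ≠ 0 := (Real.sqrt_pos.2 (by positivity)).ne'
    field_simp
  have hS : Tendsto (fun n : ℕ => position X A β Y n ω i /
      (Real.sqrt ((n : ℝ) + 1) * logNorm α n)) atTop (𝓝 0) := by
    have h1 := hY.add (hZ.const_mul μ)
    rw [mul_zero, add_zero] at h1
    refine h1.congr fun n => ?_
    rw [hpos, add_div, mul_div_assoc]
  have hratio : ∀ᶠ n : ℕ in atTop, ‖Real.sqrt ((n : ℝ) + 1) * logNorm α n *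
      (Real.sqrt (n : ℝ) * Real.log (n : ℝ) ^ α)⁻¹‖ ≤ 2 * 3 ^ α := by
    filter_upwards [eventually_ge_atTop 3] with n hn
    have hn' : (3 : ℝ) ≤ n := by exact_mod_cast hn
    have hl : 0 < Real.log n := Real.log_pos (by linarith)
    have h1 : 0 < Real.log (n : ℝ) ^ α := Real.rpow_pos_of_pos hl α
    have h2 : 0 < Real.sqrt (n : ℝ) := Real.sqrt_pos.2 (by linarith)
    have h3 : Real.sqrt ((n : ℝ) + 1) ≤ 2 * Real.sqrt n := by
      refine Real.sqrt_le_iff.2 ⟨by positivity, ?_⟩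
      rw [mul_pow, Real.sq_sqrt (by linarith)]
      linarith
    have h4 := logNorm_le (α := α) (by linarith) hn
    rw [Real.norm_of_nonneg (mul_nonneg (mul_nonneg (Real.sqrt_nonneg _) (logNorm_pos α n).le)
      (inv_nonneg.2 (mul_pos h2 h1).le)), ← div_eq_mul_inv, div_le_iff₀ (mul_pos h2 h1)]
    calc _ ≤ 2 * Real.sqrt n * (3 ^ α * Real.log n ^ α) :=
          mul_le_mul h3 h4 (logNorm_pos α n).le (by positivity)
      _ = _ := by ring
  refine (hS.zero_mul_isBoundedUnder_le (isBoundedUnder_of_eventually_le hratio)).congr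
    fun n => ?_
  have h2 := (logNorm_pos α n).ne'
  have h3 : Real.sqrt ((n : ℝ) + 1) ≠ 0 := (Real.sqrt_pos.2 (by positivity)).ne'
  simp only [div_eq_mul_inv, mul_inv]
  field_simp

end IsModel

end MERW

theorem mainTheorem10 {Ω : Type*} [MeasurableSpace Ω] (P : Measure Ω) [IsProbabilityMeasure P]
    (d : ℕ) (hd : 1 ≤ d) (p : ℝ) (hp : p = (2 * (d : ℝ) + 1) / (4 * (d : ℝ)))
    (X : ℕ → Ω → (Fin d → ℝ)) (A : ℕ → Ω → Matrix (Fin d) (Fin d) ℝ)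
    (β : ℕ → Ω → ℕ) (Y : ℕ → Ω → ℝ) (h : MERW.IsModel P d p X A β Y)
    (α : ℝ) (hα : 1 / 2 < α) :
    ∀ᵐ ω ∂P, Tendsto
      (fun n : ℕ => (Real.sqrt (n : ℝ) * Real.log (n : ℝ) ^ α)⁻¹ • MERW.position X A β Y n ω)
      atTop (𝓝 0) := by
  have := ae_all_iff.2 fun i => h.ae_tendsto_position_apply hd hp hα i
  filter_upwards [this] with ω hω
  exact tendsto_pi_nhds.2 hω
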